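/- Conventions. Let $G$ be a finite group and $\mathcal{D}$ a triangulated category with shift $[1]$. A (right) \emph{action} of $G$ on $\mathcal{D}$ consists of additive autoequivalences $F_g$ ($g\in G$) and natural isomorphisms $\delta_{g,h}\colon F_gF_h\to F_{hg}$ such that $\delta_{g,lh}\circ F_g\delta_{h,l}=\delta_{hg,l}\circ\delta_{g,h}F_l$ for all $g,h,l\in G$. It is \emph{admissible} if each $F_g$ is an exact functor, with commutation isomorphisms $F_g\circ[1]\cong[1]\circ F_g$ compatible with all $\delta_{g,h}$. The category $\mathcal{D}^G$ of equivariant objects has as objects the pairs $X=(A,\{\lambda_g\})$ with $A\in\mathcal{D}$ and isomorphisms $\lambda_g\colon F_g(A)\to A$ such that $\lambda_g\circ F_g(\lambda_h)=\lambda_{hg}\circ\delta_{g,h,A}$; $G$ acts on the right on $\mathrm{Hom}_{\mathcal{D}}(A,B)$, for equivariant objects $(A,\{\lambda^A_g\})$ and $(B,\{\lambda^B_g\})$, by $f.g=\lambda^B_g\circ F_g(f)\circ(\lambda^A_g)^{-1}$, and the morphisms of $\mathcal{D}^G$ are the $G$-invariant morphisms. Let $\omega\colon\mathcal{D}^G\to\mathcal{D}$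 be the forgetful functor and $\mathrm{Ind}\colon\mathcal{D}\to\mathcal{D}^G$ the induction functor, $\mathrm{Ind}(A)=\bigoplus_{h\in G}F_h(A)$ with the equivariant structure induced by the isomorphisms $\delta_{g,h}\colon F_gF_h(A)\to F_{hg}(A)$. The shift of $\mathcal{D}$ induces a shift of $\mathcal{D}^G$. A triangulated structure on $\mathcal{D}^G$ with this shift is \emph{canonical} if $\omega$ is exact. An object $T$ of a triangulated category is \emph{tilting} if $\mathrm{Hom}(T,T[n])=0$ for all $n\neq 0$ and the thick closure of $T$ is the whole category. It is \emph{$G$-invariant} if $F_g(T)\cong T$ for all $g\in G$. For an equivariant object $X$, the skew group ring $\mathrm{End}_{\mathcal{D}}(\omega X)G$ is the free left $\mathrm{End}_{\mathcal{D}}(\omega X)$-module with basis $G$ and multiplication $(ag)(a'g')=a\,(a'.g^{-1})\,gg'$. Write $\mathrm{gl.dim}\,R$ for the right global dimension of a ring $R$. \textbf{Proposition.} Let $G$ be a finite group and $\mathcal{D}$ an idempotent-complete triangulated category with an admissible action of $G$ such that $|G|$ is invertible in $\mathcal{D}$ (for each morphism $f$ there is a unique morphism $f'$ with $|G|f'=f$)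 and such that $\mathcal{D}^G$ admits a canonical triangulated structure, with which it is equipped. Let $T$ be a $G$-invariant tilting object of $\mathcal{D}$. Then $\mathrm{Ind}(T)$ is a tilting object of $\mathcal{D}^G$; its endomorphism ring $\mathrm{End}_{\mathcal{D}^G}(\mathrm{Ind}(T))$ is Morita equivalent to the skew group ring $\mathrm{End}_{\mathcal{D}}(\omega\,\mathrm{Ind}(T))G$; and \[\mathrm{gl.dim}\,\mathrm{End}_{\mathcal{D}^G}(\mathrm{Ind}(T))=\mathrm{gl.dim}\,\mathrm{End}_{\mathcal{D}}(T).\] -/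

import Mathlib

open CategoryTheory CategoryTheory.Limits CategoryTheory.Pretriangulated

universe w v u

noncomputable section

namespace Equivariantization

/-- A (right) action of a group `G` on an additive category `A`: additive autoequivalences `F g`
and natural isomorphisms `δ g h : F g ∘ F h ≅ F (h * g)` satisfying the `2`-cocycle condition
`δ_{g, lh} ∘ F_g(δ_{h,l}) = δ_{hg, l} ∘ δ_{g,h} F_l`.
(Note that `F h ⋙ F g` is the functor `X ↦ F g (F h X)`; the `eqToHom` below only identifies
`l * h * g` with `l * (h * g)`.) -/
structure GroupAction (G : Type w) [Group G] (A : Type u) [Category.{v} A] [Preadditive A] where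
  F : G → A ⥤ A
  isEquivalence : ∀ g, (F g).IsEquivalence
  additive : ∀ g, (F g).Additive
  δ : ∀ g h : G, F h ⋙ F g ≅ F (h * g)
  cocycle : ∀ (g h l : G) (X : A),
    (F g).map ((δ h l).hom.app X) ≫ (δ g (l * h)).hom.app X ≫
        eqToHom (by rw [mul_assoc]) =
      (δ g h).hom.app ((F l).obj X) ≫ (δ (h * g) l).hom.app X

section Additive

variable {G : Type w} [Group G] {A : Type u} [Category.{v} A] [Preadditive A]

instance (𝒢 : GroupAction G A) (g : G) : (𝒢.F g).IsEquivalence := 𝒢.isEquivalence g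

instance (𝒢 : GroupAction G A) (g : G) : (𝒢.F g).Additive := 𝒢.additive g

/-- An object `B` is `G`-invariant if `F g B ≅ B` for every `g`. -/
def GroupAction.IsInvariant (𝒢 : GroupAction G A) (B : A) : Prop :=
  ∀ g : G, Nonempty ((𝒢.F g).obj B ≅ B)

/-- The natural number `n` is invertible in the category `A`: every morphism is uniquely
divisible by `n`. -/
def IsInvertibleIn (n : ℕ) (A : Type u) [Category.{v} A] [Preadditive A] : Prop :=
  ∀ ⦃X Y : A⦄ (f : X ⟶ Y), ∃! g : X ⟶ Y, n • g = f

/-- A `G`-equivariant object: an object `X` with isomorphisms `lam g : F g X ≅ X` such that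
`lam g ∘ F g (lam h) = lam (h * g) ∘ δ g h`. These are the objects of the
equivariantization `A^G`. -/
structure EquivariantObject (𝒢 : GroupAction G A) where
  obj : A
  lam : ∀ g : G, (𝒢.F g).obj obj ≅ obj
  comm : ∀ g h : G, (𝒢.F g).map (lam h).hom ≫ (lam g).hom =
    (𝒢.δ g h).hom.app obj ≫ (lam (h * g)).hom

variable {𝒢 : GroupAction G A}

/-- The right action of `G` on morphisms between the underlying objects of two equivariant
objects: `f.g = lam_g^Y ∘ F_g(f) ∘ (lam_g^X)⁻¹`. -/
def conj {X Y : EquivariantObject 𝒢} (g : G) (f : X.obj ⟶ Y.obj) : X.obj ⟶ Y.obj :=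
  (X.lam g).inv ≫ (𝒢.F g).map f ≫ (Y.lam g).hom

/-- A morphism of equivariant objects is a `G`-invariant morphism of the underlying objects. -/
@[ext]
structure EquivariantHom (X Y : EquivariantObject 𝒢) where
  hom : X.obj ⟶ Y.obj
  invariant : ∀ g : G, conj g hom = hom

lemma conj_eq_iff {X Y : EquivariantObject 𝒢} (g : G) (f f' : X.obj ⟶ Y.obj) :
    conj g f = f' ↔ (𝒢.F g).map f ≫ (Y.lam g).hom = (X.lam g).hom ≫ f' := by
  rw [conj, Iso.inv_comp_eq]

lemma conj_id (X : EquivariantObject 𝒢) (g : G) : conj g (𝟙 X.obj) = 𝟙 X.obj := by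
  simp [conj]

lemma conj_comp {X Y Z : EquivariantObject 𝒢} (g : G) (f : X.obj ⟶ Y.obj) (f' : Y.obj ⟶ Z.obj) :
    conj g (f ≫ f') = conj (X := X) (Y := Y) g f ≫ conj (X := Y) (Y := Z) g f' := by
  simp [conj]

lemma conj_add {X Y : EquivariantObject 𝒢} (g : G) (f f' : X.obj ⟶ Y.obj) :
    conj g (f + f') = conj g f + conj g f' := by
  simp [conj, Functor.map_add]

/-- `(f.h).g = f.(hg)`. -/
lemma conj_conj {X Y : EquivariantObject 𝒢} (g h : G) (f : X.obj ⟶ Y.obj) :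
    conj g (conj h f) = conj (X := X) (Y := Y) (h * g) f := by
  rw [conj_eq_iff, ← cancel_epi ((𝒢.F g).map (X.lam h).hom), ← Functor.map_comp_assoc,
    (conj_eq_iff h f (conj h f)).1 rfl |>.symm, Functor.map_comp, Category.assoc, Y.comm,
    ← Category.assoc ((𝒢.F g).map (X.lam h).hom), X.comm, Category.assoc,
    ← (conj_eq_iff (h * g) f (conj (h * g) f)).1 rfl]
  exact (𝒢.δ g h).hom.naturality_assoc f _

lemma conj_one {X Y : EquivariantObject 𝒢} (f : X.obj ⟶ Y.obj) :
    conj (X := X) (Y := Y) 1 f = f := by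
  have h : conj (X := X) (Y := Y) 1 (conj (X := X) (Y := Y) 1 f) =
      conj (X := X) (Y := Y) 1 f := by
    rw [conj_conj, mul_one]
  have inj : Function.Injective (conj (X := X) (Y := Y) (1 : G)) := by
    intro a b hab
    simp only [conj, Iso.cancel_iso_inv_left, Iso.cancel_iso_hom_right] at hab
    exact (𝒢.F 1).map_injective hab
  exact inj h

instance : Category.{v} (EquivariantObject 𝒢) where
  Hom X Y := EquivariantHom X Y
  id X := ⟨𝟙 X.obj, conj_id X⟩
  comp f f' := ⟨f.hom ≫ f'.hom, fun g => by rw [conj_comp, f.invariant, f'.invariant]⟩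
  id_comp f := EquivariantHom.ext (Category.id_comp _)
  comp_id f := EquivariantHom.ext (Category.comp_id _)
  assoc f f' f'' := EquivariantHom.ext (Category.assoc _ _ _)

@[ext]
lemma hom_ext {X Y : EquivariantObject 𝒢} {f f' : X ⟶ Y} (h : f.hom = f'.hom) : f = f' :=
  EquivariantHom.ext h

@[simp] lemma id_hom (X : EquivariantObject 𝒢) : EquivariantHom.hom (𝟙 X) = 𝟙 X.obj := rfl

@[simp] lemma comp_hom {X Y Z : EquivariantObject 𝒢} (f : X ⟶ Y) (f' : Y ⟶ Z) :
    EquivariantHom.hom (f ≫ f') = f.hom ≫ f'.hom := rfl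

lemma eqToHom_hom {X Y : EquivariantObject 𝒢} (h : X = Y) :
    EquivariantHom.hom (eqToHom h) = eqToHom (congrArg EquivariantObject.obj h) := by
  subst h
  rfl

lemma hom_comm {X Y : EquivariantObject 𝒢} (f : X ⟶ Y) (g : G) :
    (𝒢.F g).map f.hom ≫ (Y.lam g).hom = (X.lam g).hom ≫ f.hom :=
  (conj_eq_iff g _ _).1 (f.invariant g)

/-- Build a morphism of equivariant objects from a commutation relation. -/
def mkHom {X Y : EquivariantObject 𝒢} (f : X.obj ⟶ Y.obj)
    (hf : ∀ g : G, (𝒢.F g).map f ≫ (Y.lam g).hom = (X.lam g).hom ≫ f) : X ⟶ Y :=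
  ⟨f, fun g => (conj_eq_iff g _ _).2 (hf g)⟩

@[simp] lemma mkHom_hom {X Y : EquivariantObject 𝒢} (f : X.obj ⟶ Y.obj)
    (hf : ∀ g : G, (𝒢.F g).map f ≫ (Y.lam g).hom = (X.lam g).hom ≫ f) :
    (mkHom f hf).hom = f := rfl

/-- Build an isomorphism of equivariant objects from a commutation relation. -/
def mkIso {X Y : EquivariantObject 𝒢} (e : X.obj ≅ Y.obj)
    (he : ∀ g : G, (𝒢.F g).map e.hom ≫ (Y.lam g).hom = (X.lam g).hom ≫ e.hom) : X ≅ Y where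
  hom := mkHom e.hom he
  inv := mkHom e.inv fun g => by
    rw [← cancel_epi ((𝒢.F g).map e.hom), ← Functor.map_comp_assoc, Iso.hom_inv_id,
      CategoryTheory.Functor.map_id, Category.id_comp, ← Category.assoc, he, Category.assoc,
      Iso.hom_inv_id, Category.comp_id]
  hom_inv_id := by ext; simp
  inv_hom_id := by ext; simp

@[simp] lemma mkIso_hom_hom {X Y : EquivariantObject 𝒢} (e : X.obj ≅ Y.obj)
    (he : ∀ g : G, (𝒢.F g).map e.hom ≫ (Y.lam g).hom = (X.lam g).hom ≫ e.hom) :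
    (mkIso e he).hom.hom = e.hom := rfl

@[simp] lemma mkIso_inv_hom {X Y : EquivariantObject 𝒢} (e : X.obj ≅ Y.obj)
    (he : ∀ g : G, (𝒢.F g).map e.hom ≫ (Y.lam g).hom = (X.lam g).hom ≫ e.hom) :
    (mkIso e he).inv.hom = e.inv := rfl

/-! ### The additive structure of `A^G`: addition of morphisms is that of `A` -/

lemma conj_zero {X Y : EquivariantObject 𝒢} (g : G) :
    conj (X := X) (Y := Y) g 0 = 0 := by
  simp [conj]

lemma conj_neg {X Y : EquivariantObject 𝒢} (g : G) (f : X.obj ⟶ Y.obj) :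
    conj (X := X) (Y := Y) g (-f) = -conj (X := X) (Y := Y) g f := by
  simp [conj, Functor.map_neg]

instance (X Y : EquivariantObject 𝒢) : Zero (X ⟶ Y) := ⟨⟨0, conj_zero⟩⟩

instance (X Y : EquivariantObject 𝒢) : Add (X ⟶ Y) :=
  ⟨fun f f' => ⟨f.hom + f'.hom, fun g => by rw [conj_add, f.invariant, f'.invariant]⟩⟩

instance (X Y : EquivariantObject 𝒢) : Neg (X ⟶ Y) :=
  ⟨fun f => ⟨-f.hom, fun g => by rw [conj_neg, f.invariant]⟩⟩

instance (X Y : EquivariantObject 𝒢) : AddCommGroup (X ⟶ Y) where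
  add_assoc f f' f'' := EquivariantHom.ext (add_assoc _ _ _)
  zero_add f := EquivariantHom.ext (zero_add _)
  add_zero f := EquivariantHom.ext (add_zero _)
  add_comm f f' := EquivariantHom.ext (add_comm _ _)
  neg_add_cancel f := EquivariantHom.ext (neg_add_cancel _)
  nsmul := nsmulRec
  zsmul := zsmulRec

instance : Preadditive (EquivariantObject 𝒢) where
  add_comp X Y Z f f' h := EquivariantHom.ext (Preadditive.add_comp _ _ _ _ _ _)
  comp_add X Y Z f h h' := EquivariantHom.ext (Preadditive.comp_add _ _ _ _ _ _)

@[simp] lemma add_hom {X Y : EquivariantObject 𝒢} (f f' : X ⟶ Y) :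
    EquivariantHom.hom (f + f') = f.hom + f'.hom := rfl

@[simp] lemma zero_hom {X Y : EquivariantObject 𝒢} :
    EquivariantHom.hom (0 : X ⟶ Y) = 0 := rfl

/-- The forgetful functor `ω : A^G ⥤ A`. -/
def forget (𝒢 : GroupAction G A) : EquivariantObject 𝒢 ⥤ A where
  obj X := X.obj
  map f := f.hom

instance : (forget 𝒢).Additive where

instance [HasZeroObject A] : HasZeroObject (EquivariantObject 𝒢) := by
  obtain ⟨Z, hZ⟩ := HasZeroObject.zero (C := A)
  let Z' : EquivariantObject 𝒢 :=
    { obj := Z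
      lam := fun g => ((𝒢.F g).map_isZero hZ).iso hZ
      comm := fun g h => hZ.eq_of_tgt _ _ }
  refine ⟨⟨Z', fun Y => ⟨⟨⟨0⟩, fun f => ?_⟩⟩, fun Y => ⟨⟨⟨0⟩, fun f => ?_⟩⟩⟩⟩
  · exact hom_ext (hZ.eq_of_src _ _)
  · exact hom_ext (hZ.eq_of_tgt _ _)

/-! ### The induction functor -/

section Ind

variable [HasFiniteBiproducts A] [Finite G]

instance (𝒢 : GroupAction G A) (g : G) (X : A) :
    PreservesBiproduct (fun h : G => (𝒢.F h).obj X) (𝒢.F g) :=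
  have := preservesBiproductsOfShape_of_preservesProductsOfShape (J := G) (𝒢.F g)
  inferInstance

/-- The isomorphism `F_g (⨁_h F_h X) ≅ ⨁_h F_g (F_h X) ≅ ⨁_k F_k X` which identifies the
summand `F_g (F_h X)` with the summand `F_{hg} X` by means of `δ g h`. -/
def indLam (𝒢 : GroupAction G A) (X : A) (g : G) :
    (𝒢.F g).obj (⨁ fun h : G => (𝒢.F h).obj X) ≅ ⨁ fun h : G => (𝒢.F h).obj X :=
  (𝒢.F g).mapBiproduct (fun h : G => (𝒢.F h).obj X) ≪≫
    biproduct.whiskerEquiv (f := fun h : G => (𝒢.F g).obj ((𝒢.F h).obj X))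
      (g := fun h : G => (𝒢.F h).obj X) (Equiv.mulRight g)
      (fun h => show (𝒢.F (h * g)).obj X ≅ (𝒢.F h ⋙ 𝒢.F g).obj X from
        ((𝒢.δ g h).app X).symm)

lemma ι_indLam (𝒢 : GroupAction G A) (X : A) (g h : G) :
    (𝒢.F g).map (biproduct.ι (fun h : G => (𝒢.F h).obj X) h) ≫ (indLam 𝒢 X g).hom =
      (𝒢.δ g h).hom.app X ≫ biproduct.ι (fun h : G => (𝒢.F h).obj X) (h * g) := by
  have h1 : (𝒢.F g).map (biproduct.ι (fun h : G => (𝒢.F h).obj X) h) ≫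
      ((𝒢.F g).mapBiproduct (fun h : G => (𝒢.F h).obj X)).hom =
      biproduct.ι (fun h : G => (𝒢.F g).obj ((𝒢.F h).obj X)) h := by
    rw [← Iso.eq_comp_inv, Functor.mapBiproduct_inv]
    exact (biproduct.ι_desc (f := fun h : G => (𝒢.F g).obj ((𝒢.F h).obj X))
      (fun j => (𝒢.F g).map (biproduct.ι (fun h : G => (𝒢.F h).obj X) j)) h).symm
  refine (Category.assoc _ _ _).symm.trans ((congrArg (· ≫ _) h1).trans ?_)
  exact biproduct.ι_desc (f := fun h : G => (𝒢.F g).obj ((𝒢.F h).obj X)) _ h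

lemma ι_indLam_assoc (𝒢 : GroupAction G A) (X : A) (g h : G) {Y : A}
    (f : (⨁ fun h : G => (𝒢.F h).obj X) ⟶ Y) :
    (𝒢.F g).map (biproduct.ι (fun h : G => (𝒢.F h).obj X) h) ≫ (indLam 𝒢 X g).hom ≫ f =
      (𝒢.δ g h).hom.app X ≫ biproduct.ι (fun h : G => (𝒢.F h).obj X) (h * g) ≫ f := by
  rw [← Category.assoc, ι_indLam, Category.assoc]

/-- Morphisms out of `F_g (⨁_h F_h X)` are determined on the summands. -/
lemma map_biproduct_hom_ext (𝒢 : GroupAction G A) (X Y : A) (g : G)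
    {f f' : (𝒢.F g).obj (⨁ fun h : G => (𝒢.F h).obj X) ⟶ Y}
    (w : ∀ h, (𝒢.F g).map (biproduct.ι (fun h : G => (𝒢.F h).obj X) h) ≫ f =
      (𝒢.F g).map (biproduct.ι (fun h : G => (𝒢.F h).obj X) h) ≫ f') : f = f' := by
  rw [← cancel_epi ((𝒢.F g).mapBiproduct (fun h : G => (𝒢.F h).obj X)).inv]
  refine biproduct.hom_ext' _ _ fun h => ?_
  rw [Functor.mapBiproduct_inv, biproduct.ι_desc_assoc, biproduct.ι_desc_assoc]
  exact w h

/-- The induction functor `Ind : A ⥤ A^G`, `X ↦ ⨁_h F_h X`. -/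
def Ind (𝒢 : GroupAction G A) : A ⥤ EquivariantObject 𝒢 where
  obj X :=
    { obj := ⨁ fun h : G => (𝒢.F h).obj X
      lam := indLam 𝒢 X
      comm := fun g h => by
        have : (𝒢.F h ⋙ 𝒢.F g).IsEquivalence := inferInstance
        rw [← cancel_epi ((𝒢.δ g h).inv.app _), Iso.inv_hom_id_app_assoc]
        refine map_biproduct_hom_ext 𝒢 X _ _ fun l => ?_
        rw [ι_indLam, ← Category.assoc, (𝒢.δ g h).inv.naturality, Category.assoc,
          Functor.comp_map, ← Functor.map_comp_assoc, ι_indLam, Functor.map_comp, Category.assoc,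
          ι_indLam, ← cancel_epi ((𝒢.δ g h).hom.app _), Iso.hom_inv_id_app_assoc,
          ← Category.assoc ((𝒢.δ g h).hom.app _), ← 𝒢.cocycle]
        simp only [Category.assoc]
        congr 2
        exact (biproduct.eqToHom_comp_ι (fun h : G => (𝒢.F h).obj X) (mul_assoc l h g)).symm }
  map {X Y} f := mkHom (biproduct.map fun h => (𝒢.F h).map f) fun g => by
    refine map_biproduct_hom_ext 𝒢 X _ g fun h => ?_
    rw [← Functor.map_comp_assoc, biproduct.ι_map, Functor.map_comp, Category.assoc, ι_indLam,
      ι_indLam_assoc, biproduct.ι_map, ← Category.assoc, ← Category.assoc]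
    congr 1
    exact (𝒢.δ g h).hom.naturality f
  map_id X := by ext : 2; simp
  map_comp f f' := by ext : 2; simp

end Ind

/-! ### The action of `G` on endomorphism rings -/

/-- The left action of `G` by ring automorphisms on the endomorphism ring (in `A`) of an
equivariant object which corresponds to the right action `f ↦ f.g`, that is
`g • f = f.(g⁻¹)`. With this action `SkewMonoidAlgebra (End X.obj) G` is the skew group ring
`End(X) G`: its multiplication is `(a g) (a' g') = a (a'.(g⁻¹)) (g g')`. -/
instance (X : EquivariantObject 𝒢) : MulSemiringAction G (End X.obj) where
  smul g f := conj (X := X) (Y := X) g⁻¹ f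
  one_smul f := by
    change conj (X := X) (Y := X) (1 : G)⁻¹ f = f
    rw [inv_one, conj_one]
  mul_smul g h f := by
    change conj (X := X) (Y := X) (g * h)⁻¹ f =
      conj (X := X) (Y := X) g⁻¹ (conj (X := X) (Y := X) h⁻¹ f)
    rw [conj_conj, mul_inv_rev]
  smul_zero g := conj_zero _
  smul_add g f f' := conj_add _ _ _
  smul_one g := conj_id _ _
  smul_mul g f f' := conj_comp _ _ _

/-- The skew group ring `End_A(ω X) G` of an equivariant object `X`; its elements are the formal
sums `∑ a_g g` with `a_g ∈ End_A(ω X)`. -/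
abbrev SkewGroupRing (X : EquivariantObject 𝒢) : Type (max v w) :=
  SkewMonoidAlgebra (End X.obj) G

lemma smul_end_def (X : EquivariantObject 𝒢) (g : G) (f : End X.obj) :
    g • f = conj (X := X) (Y := X) g⁻¹ f := rfl

end Additive

section Triangulated

variable {G : Type w} [Group G] {D : Type u} [Category.{v} D] [Preadditive D] [HasZeroObject D]
  [HasShift D ℤ] [∀ n : ℤ, (shiftFunctor D n).Additive] [Pretriangulated D]

/-- An admissible action on a triangulated category: each `F g` is an exact functor, with
commutation isomorphisms `F_g (X⟦n⟧) ≅ (F_g X)⟦n⟧` that are compatible with `δ`. -/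
class AdmissibleAction (𝒢 : GroupAction G D) where
  commShift : ∀ g, (𝒢.F g).CommShift ℤ
  isTriangulated : ∀ g, (𝒢.F g).IsTriangulated
  δ_commShift : ∀ g h, NatTrans.CommShift (𝒢.δ g h).hom ℤ

variable (𝒢 : GroupAction G D) [AdmissibleAction 𝒢]

instance (g : G) : (𝒢.F g).CommShift ℤ := AdmissibleAction.commShift g

instance (g : G) : (𝒢.F g).IsTriangulated := AdmissibleAction.isTriangulated g

instance (g h : G) : NatTrans.CommShift (𝒢.δ g h).hom ℤ := AdmissibleAction.δ_commShift g h

/-- The shift functors of `D^G`: `X⟦n⟧` has the equivariant structure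
`F_g (X⟦n⟧) ≅ (F_g X)⟦n⟧ ≅ X⟦n⟧`. -/
def equivariantShift (n : ℤ) : EquivariantObject 𝒢 ⥤ EquivariantObject 𝒢 where
  obj X :=
    { obj := X.obj⟦n⟧
      lam := fun g => ((𝒢.F g).commShiftIso n).app X.obj ≪≫
        (shiftFunctor D n).mapIso (X.lam g)
      comm := fun g h => by
        have h1 := NatTrans.shift_app_comm (𝒢.δ g h).hom n X.obj
        have h2 := congrArg (fun f => f⟦n⟧') (X.comm g h)
        simp only [Functor.map_comp] at h2
        simp only [Iso.trans_hom, Iso.app_hom, Functor.mapIso_hom, Functor.map_comp,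
          Category.assoc]
        rw [Functor.commShiftIso_hom_naturality_assoc, h2]
        rw [Functor.commShiftIso_comp_hom_app, Category.assoc] at h1
        rw [reassoc_of% h1] }
  map f := mkHom (f.hom⟦n⟧') fun g => by
    simp only [Iso.trans_hom, Iso.app_hom, Functor.mapIso_hom, Category.assoc]
    rw [Functor.commShiftIso_hom_naturality_assoc, ← Functor.map_comp, hom_comm,
      Functor.map_comp]
  map_id X := by ext : 1; simp
  map_comp f f' := by ext : 1; simp

lemma equivariantShift_obj_lam_hom (n : ℤ) (X : EquivariantObject 𝒢) (g : G) :
    (((equivariantShift 𝒢 n).obj X).lam g).hom =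
      ((𝒢.F g).commShiftIso n).hom.app X.obj ≫ ((X.lam g).hom)⟦n⟧' := rfl

/-- The isomorphism `X⟦0⟧ ≅ X` in `D^G`. -/
def equivariantShiftZero : equivariantShift 𝒢 0 ≅ 𝟭 _ :=
  NatIso.ofComponents
    (fun X => mkIso ((shiftFunctorZero D ℤ).app X.obj) fun g => by
      have h := NatIso.naturality_1 (shiftFunctorZero D ℤ) (X.lam g).hom
      change (𝒢.F g).map ((shiftFunctorZero D ℤ).hom.app X.obj) ≫ (X.lam g).hom =
        (((𝒢.F g).commShiftIso (0 : ℤ)).hom.app X.obj ≫ (X.lam g).hom⟦(0 : ℤ)⟧') ≫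
          (shiftFunctorZero D ℤ).hom.app X.obj
      rw [Functor.commShiftIso_zero, Functor.CommShift.isoZero_hom_app, Category.assoc,
        Category.assoc, h, Functor.id_map])
    (fun f => hom_ext ((shiftFunctorZero D ℤ).hom.naturality f.hom))

/-- The isomorphism `X⟦n + m⟧ ≅ X⟦n⟧⟦m⟧` in `D^G`. -/
def equivariantShiftAdd (n m : ℤ) :
    equivariantShift 𝒢 (n + m) ≅ equivariantShift 𝒢 n ⋙ equivariantShift 𝒢 m :=
  NatIso.ofComponents
    (fun X => mkIso ((shiftFunctorAdd D n m).app X.obj) fun g => by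
      have h := NatIso.naturality_1 (shiftFunctorAdd D n m) (X.lam g).hom
      change (𝒢.F g).map ((shiftFunctorAdd D n m).hom.app X.obj) ≫
          ((𝒢.F g).commShiftIso m).hom.app (X.obj⟦n⟧) ≫
            (((𝒢.F g).commShiftIso n).hom.app X.obj ≫ (X.lam g).hom⟦n⟧')⟦m⟧' =
        (((𝒢.F g).commShiftIso (n + m)).hom.app X.obj ≫ (X.lam g).hom⟦n + m⟧') ≫
          (shiftFunctorAdd D n m).hom.app X.obj
      rw [Functor.commShiftIso_add, Functor.CommShift.isoAdd_hom_app]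
      simp only [Category.assoc]
      rw [h, Functor.comp_map, Functor.map_comp])
    (fun f => hom_ext ((shiftFunctorAdd D n m).hom.naturality f.hom))

instance : HasShift (EquivariantObject 𝒢) ℤ :=
  hasShiftMk _ _
    { F := equivariantShift 𝒢
      zero := equivariantShiftZero 𝒢
      add := equivariantShiftAdd 𝒢
      assoc_hom_app := fun n m l X => hom_ext <| by
        simp only [comp_hom, eqToHom_hom]
        have := shiftFunctorAdd_assoc_hom_app (C := D) n m l X.obj
        simp only [shiftFunctorAdd', Iso.trans_hom, eqToIso.hom, NatTrans.comp_app,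
          eqToHom_app, Category.assoc] at this
        exact this
      zero_add_hom_app := fun n X => hom_ext <| by
        simp only [comp_hom, eqToHom_hom]
        exact shiftFunctorAdd_zero_add_hom_app n X.obj
      add_zero_hom_app := fun n X => hom_ext <| by
        simp only [comp_hom, eqToHom_hom]
        exact shiftFunctorAdd_add_zero_hom_app n X.obj }

instance (n : ℤ) : (shiftFunctor (EquivariantObject 𝒢) n).Additive where
  map_add {_ _ f f'} := hom_ext ((shiftFunctor D n).map_add (f := f.hom) (g := f'.hom))

/-- The equality `ω(X⟦n⟧) = ω(X)⟦n⟧`. -/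
def forgetShiftIso (n : ℤ) :
    shiftFunctor (EquivariantObject 𝒢) n ⋙ forget 𝒢 ≅ forget 𝒢 ⋙ shiftFunctor D n :=
  Iso.refl _

lemma forgetShiftIso_hom_app (n : ℤ) (X : EquivariantObject 𝒢) :
    (forgetShiftIso 𝒢 n).hom.app X = 𝟙 (X.obj⟦n⟧) := rfl

instance : (forget 𝒢).CommShift ℤ where
  commShiftIso n := forgetShiftIso 𝒢 n
  commShiftIso_zero := by
    ext X
    rw [Functor.CommShift.isoZero_hom_app]
    exact ((shiftFunctorZero D ℤ).hom_inv_id_app X.obj).symm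
  commShiftIso_add n m := by
    ext X
    rw [Functor.CommShift.isoAdd_hom_app]
    have h : (shiftFunctorAdd D n m).hom.app X.obj ≫ 𝟙 _ ≫ (𝟙 (X.obj⟦n⟧))⟦m⟧' ≫
        (shiftFunctorAdd D n m).inv.app X.obj = 𝟙 _ := by
      rw [CategoryTheory.Functor.map_id, Category.id_comp]
      erw [Category.id_comp]
      exact (shiftFunctorAdd D n m).hom_inv_id_app X.obj
    exact h.symm

end Triangulated

section Tilting

variable {D : Type u} [Category.{v} D] [Preadditive D] [HasZeroObject D]
  [HasShift D ℤ] [∀ n : ℤ, (shiftFunctor D n).Additive] [Pretriangulated D]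

/-- A tilting object `T` of a triangulated category: `Hom(T, T⟦n⟧) = 0` for every `n ≠ 0`, and
`T` classically generates the category, i.e. the thick closure of `T` is everything. -/
structure IsTilting (T : D) : Prop where
  hom_eq_zero : ∀ n : ℤ, n ≠ 0 → ∀ f : T ⟶ T⟦n⟧, f = 0
  generates : (ObjectProperty.singleton T).IsClassicalTriangulatedGenerator

end Tilting

/-- The right global dimension of a ring: the supremum of the projective dimensions of its right
modules, i.e. of the (left) modules over the opposite ring. -/
def rightGlobalDimension (R : Type u) [Ring R] : WithBot ℕ∞ :=
  ⨆ M : ModuleCat.{u} Rᵐᵒᵖ, projectiveDimension M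

/-- Two rings are Morita equivalent if their categories of right modules (i.e. of modules over the
opposite rings) are equivalent as additive categories. -/
def MoritaEquivalentRings (R : Type u) [Ring R] (S : Type v) [Ring S] : Prop :=
  IsMoritaEquivalent ℤ Rᵐᵒᵖ Sᵐᵒᵖ

end Equivariantization

end

open Equivariantization

/-! As `T` is `G`-invariant, `ω (Ind T)` is a direct sum of `|G|` copies of `T`. Morphisms `Ind T ⟶
(Ind T)⟦n⟧` are among the morphisms of underlying objects, which are matrices over `Hom(T, T⟦n⟧)`,
so they vanish for `n ≠ 0`. For generation, `Ind` is exact, being left adjoint to the exact functor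
`ω`, and dividing by `|G|` makes every `X` a retract of `Ind (ω X)` (`nonempty_retract_ind`,
`generates_ind`).

The rest is ring theory. Put `Q = End(ω (Ind T))` and `S = End(Ind T)`, the ring of invariants of
`Q`. The idempotents `p h` of the summands `F_h T` are permuted simply transitively by `G`, so `Q`
is a free right `S`-module with basis `p`, with coordinates given by traces. The action of the skew
group ring `QG` on this module identifies it with `Matrix G G S` (`skewEquivMatrix`), which is the
Morita equivalence.

Global dimensions are compared by `rightGlobalDimension_le_of_retraction`. The averaged trace splits
`S` off `Q`, so gl.dim `S` ≤ gl.dim `Q`; the coefficient at `1` splits `Q` off `QG`, so gl.dim `Q` ≤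
gl.dim `QG` = gl.dim `S`. Finally `Q` is a matrix ring over `End T`. -/

noncomputable section

namespace Equivariantization

/-! ### Projective dimension under exact functors and equivalences. -/

section ProjectiveDimension

variable {C : Type*} [Category* C] [Abelian C] {C' : Type*} [Category* C'] [Abelian C']

/-- An exact functor which preserves projective objects does not increase projective dimensions. -/
lemma hasProjectiveDimensionLT_obj [EnoughProjectives C] (F : C ⥤ C') [F.Additive]
    [PreservesFiniteLimits F] [PreservesFiniteColimits F] [F.PreservesProjectiveObjects]
    (n : ℕ) (X : C) (hX : HasProjectiveDimensionLT X n) :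
    HasProjectiveDimensionLT (F.obj X) n := by
  induction n generalizing X with
  | zero =>
    rw [hasProjectiveDimensionLT_zero_iff_isZero] at hX ⊢
    exact F.map_isZero hX
  | succ n ih =>
    -- The bound `1` (projective objects) is a separate case: the syzygy shift relates the bounds `n
    -- + 2` and `n + 1` only.
    obtain _ | n := n
    · rw [zero_add, ← projective_iff_hasProjectiveDimensionLT_one] at hX ⊢
      infer_instance
    · obtain ⟨P⟩ := EnoughProjectives.presentation X
      have h : (ShortComplex.mk _ _ (kernel.condition P.f)).ShortExact :=
        { exact := ShortComplex.exact_kernel P.f }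
      have hP : Projective (F.obj P.p) := inferInstance
      exact ((h.map_of_exact F).hasProjectiveDimensionLT_X₃_iff n hP).2
        (ih _ ((h.hasProjectiveDimensionLT_X₃_iff n P.projective).1 hX))

lemma projectiveDimension_obj_le [EnoughProjectives C] (F : C ⥤ C') [F.Additive]
    [PreservesFiniteLimits F] [PreservesFiniteColimits F] [F.PreservesProjectiveObjects] (X : C) :
    projectiveDimension (F.obj X) ≤ projectiveDimension X :=
  sInf_le_sInf fun _ hn i hi => hasProjectiveDimensionLT_obj F i X (hn i hi)

lemma iSup_projectiveDimension_le_of_equivalence [EnoughProjectives C'] (e : C ≌ C') :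
    ⨆ X : C, projectiveDimension X ≤ ⨆ Y : C', projectiveDimension Y := by
  have : e.inverse.Additive := Functor.additive_of_preserves_binary_products _
  exact iSup_le fun X => (projectiveDimension_eq_of_iso (e.unitIso.app X)).le.trans
    ((projectiveDimension_obj_le e.inverse (e.functor.obj X)).trans
      (le_iSup (fun Y : C' => projectiveDimension Y) (e.functor.obj X)))

lemma iSup_projectiveDimension_eq_of_equivalence [EnoughProjectives C] [EnoughProjectives C']
    (e : C ≌ C') : ⨆ X : C, projectiveDimension X = ⨆ Y : C', projectiveDimension Y :=
  le_antisymm (iSup_projectiveDimension_le_of_equivalence e)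
    (iSup_projectiveDimension_le_of_equivalence e.symm)

end ProjectiveDimension

/-! ### Global dimension: split ring extensions and matrix rings. -/

section GlobalDimension

variable {R S : Type u} [Ring R] [Ring S]

/-- If `S` is a finitely generated projective `R`-module, with dual basis `x`, `θ`, and `R` is a
direct summand of `S` as a bimodule, with retraction `π`, then the supremum of the projective
dimensions of `R`-modules is at most that of `S`-modules. -/
lemma iSup_projectiveDimension_le_of_retraction (f : R →+* S) (π : S →+ R)
    (π_left : ∀ r s, π (f r * s) = r * π s) (π_right : ∀ r s, π (s * f r) = π s * r)
    (π_one : π 1 = 1) {ι : Type*} [Fintype ι] (x : ι → S) (θ : ι → S →+ R)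
    (θ_left : ∀ i r s, θ i (f r * s) = r * θ i s) (hθ : ∀ s, ∑ i, f (θ i s) * x i = s) :
    ⨆ M : ModuleCat.{u} R, projectiveDimension M ≤
      ⨆ N : ModuleCat.{u} S, projectiveDimension N := by
  -- `Hom_R(S, -)` is exact since `S` is finitely generated projective: lift the values `φ (x i)` to
  -- `m i` and take `s ↦ ∑ θ i s • m i`. Its left adjoint, restriction of scalars, therefore
  -- preserves projectives.
  have : (ModuleCat.coextendScalars.{u, u, u} f).PreservesEpimorphisms := ⟨fun {M N} g hg => by
    rw [ModuleCat.epi_iff_surjective] at hg ⊢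
    intro φ
    choose m hm using fun i => hg (ModuleCat.CoextendScalars.equiv f N φ (x i))
    refine ⟨(ModuleCat.CoextendScalars.equiv f M).symm
      { toFun := fun s : S => ∑ i, θ i s • m i
        map_add' := fun s s' => ?_
        map_smul' := fun r s => ?_ }, ?_⟩
    · change S at s s'
      change ∑ i, θ i (s + s') • m i = ∑ i, θ i s • m i + ∑ i, θ i s' • m i
      simp [add_smul, Finset.sum_add_distrib]
    · change S at s
      change ∑ i, θ i (f r * s) • m i = r • ∑ i, θ i s • m i
      simp [θ_left, mul_smul, Finset.smul_sum]
    · refine ModuleCat.CoextendScalars.ext (LinearMap.ext fun s => ?_)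
      change g (∑ i, θ i s • m i) = ModuleCat.CoextendScalars.equiv f N φ s
      change S at s
      have h : ∀ i, ModuleCat.CoextendScalars.equiv f N φ (f (θ i s) * x i) =
          θ i s • ModuleCat.CoextendScalars.equiv f N φ (x i) := fun i =>
        (ModuleCat.CoextendScalars.equiv f N φ).map_smul (θ i s) (x i)
      have h' := congrArg (ModuleCat.CoextendScalars.equiv f N φ) (hθ s)
      refine Eq.trans ?_ ((map_sum (ModuleCat.CoextendScalars.equiv f N φ) _ _).symm.trans h')
      rw [map_sum]
      exact Finset.sum_congr rfl fun i _ => by rw [map_smul, hm, h]⟩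
  have : PreservesFiniteLimits (ModuleCat.restrictScalars.{u} f) := ⟨fun J _ _ => ⟨inferInstance⟩⟩
  have : PreservesFiniteColimits (ModuleCat.restrictScalars.{u} f) :=
    ⟨fun J _ _ => ⟨inferInstance⟩⟩
  let adj := ModuleCat.restrictCoextendScalarsAdj.{u, u, u} f
  have : (ModuleCat.restrictScalars.{u} f).PreservesProjectiveObjects :=
    ⟨fun h => adj.map_projective _ h⟩
  refine iSup_le fun M => ?_
  let N := (ModuleCat.coextendScalars.{u, u, u} f).obj M
  -- `M` is a retract of `Hom_R(S, M)`: the section is `m ↦ (s ↦ π s • m)` and the retraction is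
  -- evaluation at `1`.
  refine le_trans (Retract.projectiveDimension_le (Y := (ModuleCat.restrictScalars f).obj N)
    ⟨ModuleCat.ofHom (Y := (ModuleCat.restrictScalars f).obj N)
      { toFun := fun m => (ModuleCat.CoextendScalars.equiv f M).symm
          { toFun := fun s : S => π s • m
            map_add' := fun s s' => ?_
            map_smul' := fun r s => ?_ }
        map_add' := fun m m' => ?_
        map_smul' := fun r m => ?_ }, adj.counit.app M, ?_⟩)
    ((projectiveDimension_obj_le (ModuleCat.restrictScalars f) N).trans
      (le_iSup (fun N : ModuleCat.{u} S => projectiveDimension N) N))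
  · change S at s s'
    change π (s + s') • m = π s • m + π s' • m
    rw [map_add, add_smul]
  · change S at s
    change π (f r * s) • m = r • π s • m
    rw [π_left, mul_smul]
  · refine ModuleCat.CoextendScalars.ext (LinearMap.ext fun s => ?_)
    exact smul_add (π s) m m'
  · refine ModuleCat.CoextendScalars.ext (LinearMap.ext fun s : S => ?_)
    change π s • r • m = π (s * f r) • m
    rw [π_right, mul_smul]
  · ext m
    change π 1 • m = m
    rw [π_one, one_smul]

lemma rightGlobalDimension_le_of_retraction (f : R →+* S) (π : S →+ R)
    (π_left : ∀ r s, π (f r * s) = r * π s) (π_right : ∀ r s, π (s * f r) = π s * r)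
    (π_one : π 1 = 1) {ι : Type*} [Fintype ι] (x : ι → S) (θ : ι → S →+ R)
    (θ_right : ∀ i r s, θ i (s * f r) = θ i s * r) (hθ : ∀ s, ∑ i, x i * f (θ i s) = s) :
    rightGlobalDimension R ≤ rightGlobalDimension S :=
  iSup_projectiveDimension_le_of_retraction f.op (AddMonoidHom.mulOp π)
    (fun r s => MulOpposite.unop_injective (π_right r.unop s.unop))
    (fun r s => MulOpposite.unop_injective (π_left r.unop s.unop))
    (MulOpposite.unop_injective π_one) (fun i => MulOpposite.op (x i))
    (fun i => AddMonoidHom.mulOp (θ i))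
    (fun i r s => MulOpposite.unop_injective (θ_right i r.unop s.unop))
    (fun s => MulOpposite.unop_injective (by
      rw [Finset.unop_sum]
      exact hθ s.unop))

lemma rightGlobalDimension_congr (e : R ≃+* S) :
    rightGlobalDimension R = rightGlobalDimension S :=
  iSup_projectiveDimension_eq_of_equivalence
    (ModuleCat.restrictScalarsEquivalenceOfRingEquiv e.symm.op)

-- The index set lies in `Type` so that both rings, and the modules defining their global
-- dimensions, share a universe.
variable (R) in
lemma rightGlobalDimension_matrix (ι : Type) [Fintype ι] [DecidableEq ι] [Nonempty ι] :
    rightGlobalDimension (Matrix ι ι R) = rightGlobalDimension R :=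
  (iSup_projectiveDimension_eq_of_equivalence
    ((ModuleCat.matrixEquivalence.{u, 0} Rᵐᵒᵖ (Classical.arbitrary ι)).trans
      (ModuleCat.restrictScalarsEquivalenceOfRingEquiv RingEquiv.mopMatrix.symm))).symm

end GlobalDimension

/-! ### Morita equivalence from equivalences of module categories. -/

section Morita

open scoped ModuleCat.Algebra in
lemma isMoritaEquivalent_of_equivalence {A : Type u} {B : Type v} [Ring A] [Ring B]
    (e : ModuleCat.{max u v} A ≌ ModuleCat.{max u v} B) : IsMoritaEquivalent ℤ A B := by
  have : e.functor.Additive := Functor.additive_of_preserves_binary_products _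
  refine ⟨⟨e, ?_⟩⟩
  refine @Functor.Linear.mk _ _ _ _ _ _ _ _ (_) (_) _ ?_
  intro M N f r
  -- The `ℤ`-action on morphisms coming from the algebra structure is not syntactically `zsmul`, but
  -- any two `ℤ`-module structures agree.
  exact (congrArg e.functor.map (int_smul_eq_zsmul
      (@Linear.homModule ℤ _ _ _ _ ModuleCat.Algebra.instLinear M N) r f)).trans
    (e.functor.map_zsmul.trans (int_smul_eq_zsmul
      (@Linear.homModule ℤ _ _ _ _ ModuleCat.Algebra.instLinear _ _) r (e.functor.map f)).symm)

lemma moritaEquivalentRings_matrix {R : Type v} {S : Type max v w} [Ring R] [Ring S]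
    {ι : Type w} [Fintype ι] [DecidableEq ι] [Nonempty ι] (e : S ≃+* Matrix ι ι R) :
    MoritaEquivalentRings R S :=
  isMoritaEquivalent_of_equivalence
    ((ModuleCat.matrixEquivalence.{v, w} Rᵐᵒᵖ (Classical.arbitrary ι)).trans
      (ModuleCat.restrictScalarsEquivalenceOfRingEquiv (e.op.trans RingEquiv.mopMatrix.symm)))

end Morita

/-! ### Skew group rings, invariants and traces. -/

section SkewGroupRing

/-- The data of a ring `Q` with an action of a finite group `G`, a complete family `p` of orthogonal
idempotents which is permuted simply transitively by `G`, and an injective ring homomorphism `i`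
whose image is the ring of invariants. -/
structure InducedRing {G Q S : Type*} [Group G] [Fintype G] [Ring Q] [Ring S]
    [MulSemiringAction G Q] (i : S →+* Q) (p : G → Q) : Prop where
  idem : CompleteOrthogonalIdempotents p
  smul : ∀ g h, g • p h = p (h * g⁻¹)
  injective : Function.Injective i
  exists_eq : ∀ q, (∀ g : G, g • q = q) → ∃ s, i s = q
  smul_map : ∀ (g : G) s, g • i s = i s

namespace InducedRing

variable {G Q S : Type*} [Group G] [Fintype G] [Ring Q] [Ring S]
  [MulSemiringAction G Q] {i : S →+* Q} {p : G → Q} (H : InducedRing i p)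
include H

lemma mul_eq [DecidableEq G] (g h : G) : p g * p h = if g = h then p g else 0 := by
  split_ifs with hgh
  · rw [← hgh]
    exact H.idem.idem g
  · exact H.idem.ortho hgh

/-- The trace map `Q → S`, `q ↦ ∑ g • q`. -/
def trace : Q →+ S where
  toFun q := (H.exists_eq (∑ g : G, g • q) fun h => by
    rw [Finset.smul_sum]
    exact Fintype.sum_equiv (Equiv.mulLeft h) _ _ fun g => by simp [mul_smul]).choose
  map_zero' := H.injective (by rw [Exists.choose_spec (p := fun s => i s = _)]; simp)
  map_add' q q' := H.injective (by
    rw [map_add, Exists.choose_spec (p := fun s => i s = _),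
      Exists.choose_spec (p := fun s => i s = _), Exists.choose_spec (p := fun s => i s = _)]
    simp [Finset.sum_add_distrib])

@[simp] lemma map_trace (q : Q) : i (H.trace q) = ∑ g : G, g • q :=
  Exists.choose_spec (p := fun s => i s = _) _

lemma trace_mul (q : Q) (s : S) : H.trace (q * i s) = H.trace q * s :=
  H.injective (by simp [H.smul_map, Finset.sum_mul])

lemma trace_map_mul (q : Q) (s : S) : H.trace (i s * q) = s * H.trace q :=
  H.injective (by simp [H.smul_map, Finset.mul_sum])

/-- The family `p` spans `Q` over `S`: in `p c * ∑ g • (p c * q)` only `g = 1` survives, because `g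
• p c` is orthogonal to `p c` otherwise. -/
lemma sum_mul_trace (q : Q) : ∑ c, p c * i (H.trace (p c * q)) = q := by
  classical
  have : ∀ c, p c * i (H.trace (p c * q)) = p c * q := fun c => by
    rw [map_trace, Finset.mul_sum, Finset.sum_eq_single 1]
    · rw [one_smul, ← mul_assoc, H.mul_eq, if_pos rfl]
    · intro g _ hg
      rw [smul_mul', H.smul, ← mul_assoc, H.mul_eq, if_neg (by simpa using hg), zero_mul]
    · simp
  simp only [this, ← Finset.sum_mul, H.idem.complete, one_mul]

/-- Freeness of the basis `p`: the orbit of `p c` runs once through the whole family, whose sum is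
`1`. -/
lemma trace_mul_eq [DecidableEq G] (c d : G) :
    H.trace (p c * p d) = if c = d then 1 else 0 := by
  refine H.injective ?_
  rw [H.mul_eq]
  split_ifs
  · rw [map_trace, map_one, ← H.idem.complete]
    exact Fintype.sum_equiv ((Equiv.inv G).trans (Equiv.mulLeft c)) _ _ fun g => by simp [H.smul]
  · simp

/-- The action of the skew group ring on `Q`, as matrices with respect to the `S`-basis `p` of
`Q`. -/
def toMatrix : SkewMonoidAlgebra Q G →+ Matrix G G S where
  -- As `g • p d = p (d * g⁻¹)`, the sum is `x` applied to `p d`; `H.trace (p c * ·)` reads off the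
  -- coordinate at `c`.
  toFun x := Matrix.of fun c d => H.trace (p c * ∑ g, x.coeff g * p (d * g⁻¹))
  map_zero' := by ext; simp
  map_add' x y := by
    ext
    simp [add_mul, Finset.sum_add_distrib, mul_add]

lemma toMatrix_apply (x : SkewMonoidAlgebra Q G) (c d : G) :
    H.toMatrix x c d = H.trace (p c * ∑ g, x.coeff g * p (d * g⁻¹)) := rfl

lemma toMatrix_single (g : G) (a : Q) (c d : G) :
    H.toMatrix (SkewMonoidAlgebra.single g a) c d = H.trace (p c * (a * p (d * g⁻¹))) := by
  classical
  rw [toMatrix_apply, Finset.sum_eq_single g]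
  · simp
  · intro h _ hh
    simp [hh.symm]
  · simp

lemma toMatrix_mul (x y : SkewMonoidAlgebra Q G) :
    H.toMatrix (x * y) = H.toMatrix x * H.toMatrix y := by
  induction x with
  | add x x' hx hx' => simp only [add_mul, map_add, hx, hx']
  | single g a =>
    induction y with
    | add y y' hy hy' => simp only [mul_add, map_add, hy, hy']
    | single h b =>
      ext c d
      rw [SkewMonoidAlgebra.single_mul_single, Matrix.mul_apply, toMatrix_single]
      simp only [toMatrix_single]
      simp only [← trace_mul, ← map_sum]
      -- Expand the image of `p d` under the second factor in the basis `p`, then apply the first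
      -- factor.
      have h₁ := congrArg (fun q => p c * (a * g • q)) (H.sum_mul_trace (b * p (d * h⁻¹)))
      simp only [Finset.smul_sum, Finset.mul_sum, smul_mul', H.smul, H.smul_map] at h₁
      simp only [mul_assoc] at h₁ ⊢
      rw [h₁, mul_inv_rev]

lemma toMatrix_bijective : Function.Bijective H.toMatrix := by
  classical
  constructor
  · rw [injective_iff_map_eq_zero]
    intro x hx
    have h₁ : ∀ d, ∑ g, x.coeff g * p (d * g⁻¹) = 0 := fun d => by
      rw [← H.sum_mul_trace (∑ g, x.coeff g * p (d * g⁻¹))]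
      refine Finset.sum_eq_zero fun c _ => ?_
      rw [← H.toMatrix_apply, hx, Matrix.zero_apply, map_zero, mul_zero]
    refine SkewMonoidAlgebra.coeff_injective (Finsupp.ext fun h => ?_)
    -- Right multiplication by `p (d * h⁻¹)` isolates the term `g = h`.
    have h₂ : ∀ d, x.coeff h * p (d * h⁻¹) = 0 := fun d => by
      have := congrArg (· * p (d * h⁻¹)) (h₁ d)
      simpa [Finset.sum_mul, mul_assoc, H.mul_eq] using this
    have h₃ : ∑ d, p (d * h⁻¹) = 1 :=
      (Equiv.sum_comp (Equiv.mulRight h⁻¹) p).trans H.idem.complete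
    rw [← mul_one (x.coeff h), ← h₃, Finset.mul_sum]
    exact Finset.sum_eq_zero fun d _ => h₂ d
  · intro M
    -- The preimage must send `p d` to `∑ c, p c * i (M c d)`; this prescribes its `g`-coefficient
    -- times `p (d * g⁻¹)` for each `d`, and these pieces are summed over `d`.
    refine ⟨⟨Finsupp.equivFunOnFinite.symm fun g => ∑ c, ∑ d, p c * i (M c d) * p (d * g⁻¹)⟩, ?_⟩
    ext c d
    have h₁ : ∀ g, (∑ a, ∑ b, p a * i (M a b) * p (b * g⁻¹)) * p (d * g⁻¹) =
        (∑ a, p a * i (M a d)) * p (d * g⁻¹) := fun g => by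
      simp [Finset.sum_mul, mul_assoc, H.mul_eq]
    have h₃ : ∑ g, p (d * g⁻¹) = 1 :=
      (Equiv.sum_comp ((Equiv.inv G).trans (Equiv.mulLeft d)) p).trans H.idem.complete
    rw [toMatrix_apply]
    simp only [Finsupp.equivFunOnFinite_symm_apply_apply, h₁, ← Finset.mul_sum, h₃, mul_one]
    simp [Finset.mul_sum, ← mul_assoc, trace_mul, trace_mul_eq]

/-- The skew group ring is a matrix ring over the ring of invariants. -/
def skewEquivMatrix : SkewMonoidAlgebra Q G ≃+* Matrix G G S :=
  { Equiv.ofBijective H.toMatrix H.toMatrix_bijective with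
    map_mul' := H.toMatrix_mul
    map_add' := map_add H.toMatrix }

end InducedRing

/-- The coefficient at `1` is a bimodule retraction, and the skew group ring is a free right
`Q`-module on `G`: since `a g = g (g⁻¹ • a)`, the coordinates are `g⁻¹ • x.coeff g`. -/
lemma rightGlobalDimension_le_skew (G : Type) {Q : Type v} [Group G] [Fintype G] [Ring Q]
    [MulSemiringAction G Q] :
    rightGlobalDimension Q ≤ rightGlobalDimension (SkewMonoidAlgebra Q G) := by
  refine rightGlobalDimension_le_of_retraction SkewMonoidAlgebra.singleOneRingHom
    (AddMonoidHom.mk' (fun x => x.coeff 1) fun x y => by simp) ?_ ?_ ?_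
    (fun g : G => SkewMonoidAlgebra.single g 1)
    (fun g => AddMonoidHom.mk' (fun x => g⁻¹ • x.coeff g) ?_) ?_ ?_
  · intro r s
    exact SkewMonoidAlgebra.coeff_single_one_mul s r 1
  · intro r s
    refine (SkewMonoidAlgebra.coeff_mul_single_one s r 1).trans ?_
    rw [one_smul]
    rfl
  · exact Finsupp.single_eq_same
  · intro x y
    rw [SkewMonoidAlgebra.coeff_add, Finsupp.add_apply, smul_add]
  · intro g r s
    change g⁻¹ • (s * SkewMonoidAlgebra.single 1 r).coeff g = g⁻¹ • s.coeff g * r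
    rw [SkewMonoidAlgebra.coeff_mul_single_one, smul_mul', inv_smul_smul]
  · intro s
    change ∑ g, SkewMonoidAlgebra.single g 1 * SkewMonoidAlgebra.single 1 (g⁻¹ • s.coeff g) = s
    simp only [SkewMonoidAlgebra.single_mul_single, mul_one, one_mul, smul_inv_smul]
    conv_rhs => rw [← s.sum_single]
    rw [SkewMonoidAlgebra.sum_def']
    symm
    refine Finset.sum_subset (Finset.subset_univ _) ?_
    intro g _ hg
    rw [show s.coeff g = 0 by simpa [SkewMonoidAlgebra.support] using hg]
    simp

namespace InducedRing

variable {G : Type w} {Q S : Type v} [Group G] [Fintype G] [Ring Q] [Ring S]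
  [MulSemiringAction G Q] {i : S →+* Q} {p : G → Q} (H : InducedRing i p)
include H

/-- The retraction is the averaged trace, normalized because `1` has trace `|G|`; the dual basis is
`p` with its trace coordinates. -/
lemma rightGlobalDimension_le (u : Q) (hu : (Nat.card G : Q) * u = 1) :
    rightGlobalDimension S ≤ rightGlobalDimension Q := by
  -- Uniqueness of the inverse of `|G|` makes `u` invariant, so it comes from some `n` in `S`;
  -- centrality of `n` gives left linearity of the averaged trace.
  have hu' : ∀ g : G, g • u = u := fun g => by
    have h₁ : (Nat.card G : Q) * g • u = 1 := by
      have := congrArg (g • ·) hu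
      simpa [smul_mul', smul_one, ← MulSemiringAction.toRingHom_apply] using this
    have h₂ : u * (Nat.card G : Q) = 1 := by rw [← Nat.cast_comm, hu]
    rw [← one_mul (g • u), ← h₂, mul_assoc, h₁, mul_one]
  obtain ⟨n, hn⟩ := H.exists_eq u hu'
  have hn₁ : ∀ s : S, n * s = s * n := fun s => H.injective (by
    have h₂ : u * (Nat.card G : Q) = 1 := by rw [← Nat.cast_comm, hu]
    rw [map_mul, map_mul, hn]
    calc u * i s = u * (i s * ((Nat.card G : Q) * u)) := by rw [hu, mul_one]
      _ = u * (Nat.card G : Q) * i s * u := by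
        rw [← mul_assoc (i s), ← Nat.cast_comm]
        simp only [mul_assoc]
      _ = i s * u := by rw [h₂, one_mul])
  refine rightGlobalDimension_le_of_retraction i ((AddMonoidHom.mulLeft n).comp H.trace) ?_ ?_ ?_
    p (fun c => H.trace.comp (AddMonoidHom.mulLeft (p c))) ?_ H.sum_mul_trace
  · intro s q
    change n * H.trace (i s * q) = s * (n * H.trace q)
    rw [trace_map_mul, ← mul_assoc, hn₁, mul_assoc]
  · intro s q
    change n * H.trace (q * i s) = n * H.trace q * s
    rw [trace_mul, mul_assoc]
  · refine H.injective ?_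
    change i (n * H.trace 1) = i 1
    rw [map_mul, map_trace, hn, map_one]
    simp only [smul_one, Finset.sum_const, Finset.card_univ, nsmul_one]
    rw [← Nat.card_eq_fintype_card, ← Nat.cast_comm, hu]
  · intro c s q
    change H.trace (p c * (q * i s)) = H.trace (p c * q) * s
    rw [← mul_assoc, trace_mul]

lemma rightGlobalDimension_ge : rightGlobalDimension Q ≤ rightGlobalDimension S := by
  classical
  -- A copy of `G` in `Type` keeps the skew group ring in the universe of `Q`.
  let e := (Shrink.mulEquiv.{0} (α := G))
  let : MulSemiringAction (Shrink.{0} G) Q := MulSemiringAction.compHom Q e.toMonoidHom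
  have : Fintype (Shrink.{0} G) := Fintype.ofFinite _
  have H' : InducedRing (G := Shrink.{0} G) i (p ∘ e) :=
    { idem := CompleteOrthogonalIdempotents.equiv e.toEquiv |>.2 H.idem
      smul := fun g h => (H.smul (e g) (e h)).trans (by simp)
      injective := H.injective
      exists_eq := fun q hq => H.exists_eq q fun g => by
        obtain ⟨g, rfl⟩ := e.surjective g
        exact hq g
      smul_map := fun g s => H.smul_map (e g) s }
  rw [← rightGlobalDimension_matrix S (Shrink.{0} G),
    ← rightGlobalDimension_congr H'.skewEquivMatrix]
  exact rightGlobalDimension_le_skew _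

end InducedRing

end SkewGroupRing

/-! ### Direct sums of copies of one object. -/

section CopyDecomposition

variable {A : Type u} [Category.{v} A] [Preadditive A]

/-- A decomposition of `X` as a finite direct sum of copies of `T`, indexed by `ι`. -/
structure CopyDecomposition (ι : Type*) [Fintype ι] [DecidableEq ι] (T X : A) where
  inj : ι → (T ⟶ X)
  proj : ι → (X ⟶ T)
  inj_proj : ∀ i j, inj i ≫ proj j = if i = j then 𝟙 T else 0
  total : ∑ i, proj i ≫ inj i = 𝟙 X

namespace CopyDecomposition

variable {ι : Type*} [Fintype ι] [DecidableEq ι] {T X : A} (E : CopyDecomposition ι T X)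

lemma sum_comp_comp {Y Z : A} (f : Y ⟶ X) (f' : X ⟶ Z) :
    ∑ i, (f ≫ E.proj i) ≫ E.inj i ≫ f' = f ≫ f' := by
  have h : ∀ i, (f ≫ E.proj i) ≫ E.inj i ≫ f' = f ≫ (E.proj i ≫ E.inj i) ≫ f' := by simp
  simp only [h, ← Preadditive.comp_sum, ← Preadditive.sum_comp, E.total, Category.id_comp]

lemma sum_entries (f : X ⟶ X) :
    ∑ k, ∑ l, E.proj l ≫ (E.inj l ≫ f ≫ E.proj k) ≫ E.inj k = f := by
  have h : ∀ k l, E.proj l ≫ (E.inj l ≫ f ≫ E.proj k) ≫ E.inj k =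
      (E.proj l ≫ E.inj l) ≫ f ≫ E.proj k ≫ E.inj k := by simp
  simp only [h]
  simp only [← Preadditive.sum_comp, ← Preadditive.comp_sum, E.total, Category.id_comp,
    Category.comp_id]

lemma entry_sum (m : ι → ι → (T ⟶ T)) (k l : ι) :
    E.inj l ≫ (∑ i, ∑ j, E.proj j ≫ m i j ≫ E.inj i) ≫ E.proj k = m k l := by
  have h : ∀ i j, E.inj l ≫ (E.proj j ≫ m i j ≫ E.inj i) ≫ E.proj k =
      (E.inj l ≫ E.proj j) ≫ m i j ≫ (E.inj i ≫ E.proj k) := by simp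
  simp only [Preadditive.sum_comp, Preadditive.comp_sum, h, E.inj_proj]
  rw [Finset.sum_eq_single k, Finset.sum_eq_single l]
  · simp
  · intro j _ hj
    simp [hj.symm]
  · simp
  · intro i _ hi
    simp [hi]
  · simp

/-- The endomorphism ring of a direct sum of copies of `T` is a matrix ring over `End T`. -/
def endEquivMatrix : End X ≃+* Matrix ι ι (End T) where
  toFun f := Matrix.of fun k l => E.inj l ≫ f ≫ E.proj k
  invFun M := ∑ k, ∑ l, E.proj l ≫ M k l ≫ E.inj k
  left_inv f := E.sum_entries f
  right_inv M := Matrix.ext fun k l => E.entry_sum M k l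
  map_mul' f f' := by
    ext k l
    rw [Matrix.mul_apply]
    -- Multiplication in `End` is `f * f' = f' ≫ f`, so rows index projections and columns index
    -- inclusions.
    change E.inj l ≫ (f' ≫ f) ≫ E.proj k =
      ∑ m, (E.inj l ≫ f' ≫ E.proj m) ≫ (E.inj m ≫ f ≫ E.proj k)
    have h := E.sum_comp_comp (E.inj l ≫ f') (f ≫ E.proj k)
    simp only [Category.assoc] at h ⊢
    exact h.symm
  map_add' f f' := Matrix.ext fun k l => by
    change E.inj l ≫ (f + f') ≫ E.proj k = E.inj l ≫ f ≫ E.proj k + E.inj l ≫ f' ≫ E.proj k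
    rw [Preadditive.add_comp, Preadditive.comp_add]

/-- Reindexing the summands. -/
def reindex {κ : Type*} [Fintype κ] [DecidableEq κ] (e : κ ≃ ι) : CopyDecomposition κ T X where
  inj k := E.inj (e k)
  proj k := E.proj (e k)
  inj_proj k l := by simp [E.inj_proj]
  total := (Equiv.sum_comp e fun i => E.proj i ≫ E.inj i).trans E.total

-- A morphism `X ⟶ F X` is a matrix of morphisms `T ⟶ F T`. Applied with `F` a shift.
include E in
lemma eq_zero (F : A ⥤ A) [F.Additive] (hT : ∀ f : T ⟶ F.obj T, f = 0) (f : X ⟶ F.obj X) :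
    f = 0 := by
  have h : f = 𝟙 X ≫ f ≫ F.map (𝟙 X) := by simp
  rw [h, ← E.total, F.map_sum, Preadditive.sum_comp]
  refine Finset.sum_eq_zero fun i _ => ?_
  rw [Preadditive.comp_sum, Preadditive.comp_sum]
  refine Finset.sum_eq_zero fun j _ => ?_
  have : E.inj i ≫ f ≫ F.map (E.proj j) = 0 := hT _
  rw [F.map_comp, Category.assoc, reassoc_of% this, zero_comp, comp_zero]

end CopyDecomposition

end CopyDecomposition

/-! ### Summands of the induced object and its endomorphism ring. -/

section Additive

variable {G : Type w} [Group G] [Finite G] {A : Type u} [Category.{v} A] [Preadditive A]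
  [HasFiniteBiproducts A] (𝒢 : GroupAction G A)

/-- The inclusion of the summand `F_h T` of `ω (Ind T)`. -/
def indι (T : A) (h : G) : (𝒢.F h).obj T ⟶ ((Ind 𝒢).obj T).obj :=
  biproduct.ι (fun h : G => (𝒢.F h).obj T) h

/-- The projection onto the summand `F_h T` of `ω (Ind T)`. -/
def indπ (T : A) (h : G) : ((Ind 𝒢).obj T).obj ⟶ (𝒢.F h).obj T :=
  biproduct.π (fun h : G => (𝒢.F h).obj T) h

lemma indι_indπ_self (T : A) (h : G) : indι 𝒢 T h ≫ indπ 𝒢 T h = 𝟙 _ :=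
  biproduct.ι_π_self _ _

lemma indι_indπ_self_assoc (T : A) (h : G) {Y : A} (f : (𝒢.F h).obj T ⟶ Y) :
    indι 𝒢 T h ≫ indπ 𝒢 T h ≫ f = f := by
  rw [← Category.assoc, indι_indπ_self, Category.id_comp]

lemma indι_indπ_ne (T : A) {g h : G} (hgh : g ≠ h) : indι 𝒢 T g ≫ indπ 𝒢 T h = 0 :=
  biproduct.ι_π_ne _ hgh

lemma indι_indπ_ne_assoc (T : A) {g h : G} (hgh : g ≠ h) {Y : A} (f : (𝒢.F h).obj T ⟶ Y) :
    indι 𝒢 T g ≫ indπ 𝒢 T h ≫ f = 0 := by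
  rw [← Category.assoc, indι_indπ_ne 𝒢 T hgh, zero_comp]

lemma sum_indπ_indι [Fintype G] (T : A) :
    ∑ h, indπ 𝒢 T h ≫ indι 𝒢 T h = 𝟙 ((Ind 𝒢).obj T).obj := by
  classical
  refine biproduct.hom_ext' _ _ fun g => ?_
  change indι 𝒢 T g ≫ _ = indι 𝒢 T g ≫ _
  rw [Preadditive.comp_sum, Finset.sum_eq_single g]
  · rw [indι_indπ_self_assoc, Category.comp_id]
  · intro h _ hh
    rw [indι_indπ_ne_assoc _ _ hh.symm]
  · simp

lemma ind_hom_ext {T Y : A} {f f' : ((Ind 𝒢).obj T).obj ⟶ Y}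
    (w : ∀ h, indι 𝒢 T h ≫ f = indι 𝒢 T h ≫ f') : f = f' :=
  biproduct.hom_ext' _ _ w

lemma map_ind_hom_ext {T Y : A} {g : G} {f f' : (𝒢.F g).obj ((Ind 𝒢).obj T).obj ⟶ Y}
    (w : ∀ h, (𝒢.F g).map (indι 𝒢 T h) ≫ f = (𝒢.F g).map (indι 𝒢 T h) ≫ f') : f = f' :=
  map_biproduct_hom_ext 𝒢 T Y g w

lemma map_indι_lam (T : A) (g h : G) :
    (𝒢.F g).map (indι 𝒢 T h) ≫ (((Ind 𝒢).obj T).lam g).hom =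
      (𝒢.δ g h).hom.app T ≫ indι 𝒢 T (h * g) :=
  ι_indLam 𝒢 T g h

lemma map_indι_lam_assoc (T : A) (g h : G) {Y : A} (f : ((Ind 𝒢).obj T).obj ⟶ Y) :
    (𝒢.F g).map (indι 𝒢 T h) ≫ (((Ind 𝒢).obj T).lam g).hom ≫ f =
      (𝒢.δ g h).hom.app T ≫ indι 𝒢 T (h * g) ≫ f :=
  ι_indLam_assoc 𝒢 T g h f

lemma indι_map {T T' : A} (f : T ⟶ T') (h : G) :
    indι 𝒢 T h ≫ ((Ind 𝒢).map f).hom = (𝒢.F h).map f ≫ indι 𝒢 T' h :=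
  biproduct.ι_map (fun h : G => (𝒢.F h).map f) h

lemma indι_map_assoc {T T' : A} (f : T ⟶ T') (h : G) {Y : A}
    (f' : ((Ind 𝒢).obj T').obj ⟶ Y) :
    indι 𝒢 T h ≫ ((Ind 𝒢).map f).hom ≫ f' = (𝒢.F h).map f ≫ indι 𝒢 T' h ≫ f' := by
  rw [← Category.assoc, indι_map, Category.assoc]

variable {𝒢} in
/-- The underlying object of `Ind T` is a direct sum of copies of a `G`-invariant object `T`. -/
def indCopyDecomposition {T : A} [Fintype G] [DecidableEq G] (e : ∀ g, (𝒢.F g).obj T ≅ T) :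
    CopyDecomposition G T ((Ind 𝒢).obj T).obj where
  inj g := (e g).inv ≫ indι 𝒢 T g
  proj g := indπ 𝒢 T g ≫ (e g).hom
  inj_proj i j := by
    split_ifs with hij
    · subst hij
      simp [indι_indπ_self_assoc]
    · simp [indι_indπ_ne_assoc 𝒢 T hij]
  total := by simp [sum_indπ_indι]

/-- The idempotent endomorphism of `ω (Ind T)` attached to the summand `F_h T`. -/
def indIdempotent (T : A) (h : G) : End ((Ind 𝒢).obj T).obj :=
  indπ 𝒢 T h ≫ indι 𝒢 T h

/-- The equivariant structure carries the summand `F_g F_h T` to `F_{hg} T` through `δ g h`. -/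
lemma conj_indIdempotent (T : A) (g h : G) :
    conj (X := (Ind 𝒢).obj T) (Y := (Ind 𝒢).obj T) g (indIdempotent 𝒢 T h) =
      indIdempotent 𝒢 T (h * g) := by
  rw [conj_eq_iff]
  refine map_ind_hom_ext 𝒢 fun k => ?_
  rw [map_indι_lam_assoc, ← Functor.map_comp_assoc, indIdempotent, indIdempotent]
  by_cases hkh : k = h
  · subst hkh
    rw [indι_indπ_self_assoc, indι_indπ_self_assoc, map_indι_lam]
  · rw [indι_indπ_ne_assoc 𝒢 T hkh, indι_indπ_ne_assoc 𝒢 T (by simpa using hkh)]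
    simp

/-- The forgetful functor on endomorphism rings. -/
def endForget (X : EquivariantObject 𝒢) : End X →+* End X.obj where
  toFun f := f.hom
  map_one' := rfl
  map_mul' _ _ := rfl
  map_zero' := rfl
  map_add' _ _ := rfl

lemma inducedRing_ind (T : A) [Fintype G] :
    InducedRing (endForget 𝒢 ((Ind 𝒢).obj T)) (indIdempotent 𝒢 T) where
  idem := by
    refine CompleteOrthogonalIdempotents.iff_ortho_complete.2 ⟨fun g h hgh => ?_, ?_⟩
    · change (indπ 𝒢 T h ≫ indι 𝒢 T h) ≫ indπ 𝒢 T g ≫ indι 𝒢 T g = 0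
      simp [indι_indπ_ne_assoc 𝒢 T hgh.symm]
    · exact sum_indπ_indι 𝒢 T
  smul g h := conj_indIdempotent 𝒢 T g⁻¹ h
  injective f f' h := hom_ext h
  exists_eq q hq := ⟨⟨q, fun g => by simpa [smul_end_def] using hq g⁻¹⟩, rfl⟩
  smul_map g s := s.invariant g⁻¹

/-! ### The adjunction between induction and the forgetful functor, and averaging. -/

variable {𝒢}

/-- The morphism `ω (Ind T) ⟶ ω X` induced by `f : T ⟶ ω X`. -/
def indDescHom {T : A} {X : EquivariantObject 𝒢} (f : T ⟶ X.obj) :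
    ((Ind 𝒢).obj T).obj ⟶ X.obj :=
  biproduct.desc fun h => (𝒢.F h).map f ≫ (X.lam h).hom

lemma indι_indDescHom {T : A} {X : EquivariantObject 𝒢} (f : T ⟶ X.obj) (h : G) :
    indι 𝒢 T h ≫ indDescHom f = (𝒢.F h).map f ≫ (X.lam h).hom :=
  biproduct.ι_desc _ _

/-- The morphism `Ind T ⟶ X` induced by `f : T ⟶ ω X`. -/
def indDesc {T : A} {X : EquivariantObject 𝒢} (f : T ⟶ X.obj) : (Ind 𝒢).obj T ⟶ X :=
  mkHom (indDescHom f) fun g => by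
    refine map_ind_hom_ext 𝒢 fun h => ?_
    rw [map_indι_lam_assoc, ← Functor.map_comp_assoc, indι_indDescHom, indι_indDescHom,
      Functor.map_comp, Category.assoc, X.comm]
    exact (𝒢.δ g h).hom.naturality_assoc f _

lemma indι_indDesc {T : A} {X : EquivariantObject 𝒢} (f : T ⟶ X.obj) (h : G) :
    indι 𝒢 T h ≫ (indDesc f).hom = (𝒢.F h).map f ≫ (X.lam h).hom :=
  indι_indDescHom f h

lemma indι_indDesc_assoc {T Y : A} {X : EquivariantObject 𝒢} (f : T ⟶ X.obj) (h : G)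
    (f' : X.obj ⟶ Y) :
    indι 𝒢 T h ≫ (indDesc f).hom ≫ f' = (𝒢.F h).map f ≫ (X.lam h).hom ≫ f' := by
  rw [← Category.assoc, indι_indDesc, Category.assoc]

/-- An equivariant morphism out of `Ind T` is determined by its component at `1`. Since `F 1` need
not be the identity, its full faithfulness recovers `f` from that component. -/
lemma indDesc_bijective (T : A) (X : EquivariantObject 𝒢) :
    Function.Bijective (indDesc : (T ⟶ X.obj) → ((Ind 𝒢).obj T ⟶ X)) := by
  constructor
  · intro f f' h
    have := (indι_indDesc f 1).symm.trans ((congrArg (indι 𝒢 T 1 ≫ ·.hom) h).trans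
      (indι_indDesc f' 1))
    exact (𝒢.F 1).map_injective ((cancel_mono _).1 this)
  · intro φ
    obtain ⟨f, hf⟩ := (𝒢.F 1).map_surjective (indι 𝒢 T 1 ≫ φ.hom ≫ (X.lam 1).inv)
    refine ⟨f, hom_ext (ind_hom_ext 𝒢 fun h => ?_)⟩
    rw [indι_indDesc]
    have hf' : (𝒢.F 1).map f ≫ (X.lam 1).hom = indι 𝒢 T 1 ≫ φ.hom := by
      rw [hf]
      simp
    -- `δ h 1` transports the component at `1` to the component at `1 * h`.
    suffices (𝒢.F (1 * h)).map f ≫ (X.lam (1 * h)).hom = indι 𝒢 T (1 * h) ≫ φ.hom by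
      rwa [one_mul] at this
    rw [← cancel_epi ((𝒢.δ h 1).hom.app T), ← map_indι_lam_assoc]
    have h₁ := (𝒢.δ h 1).hom.naturality_assoc f (X.lam (1 * h)).hom
    refine h₁.symm.trans ?_
    rw [← X.comm, Functor.comp_map, ← Functor.map_comp_assoc, hf', Functor.map_comp,
      Category.assoc, hom_comm]

variable (𝒢) in
/-- Induction is left adjoint to the forgetful functor. -/
def indAdjunction : Ind 𝒢 ⊣ forget 𝒢 :=
  Adjunction.mkOfHomEquiv
    { homEquiv := fun T X => (Equiv.ofBijective indDesc (indDesc_bijective T X)).symm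
      homEquiv_naturality_left_symm := fun {T T' X} f (g : T' ⟶ X.obj) =>
        hom_ext <| ind_hom_ext 𝒢 fun h => by
        change _ ≫ (indDesc (f ≫ g)).hom = _ ≫ ((Ind 𝒢).map f).hom ≫ (indDesc (X := X) g).hom
        rw [indι_indDesc (f ≫ g) h, indι_map_assoc, indι_indDesc, Functor.map_comp, Category.assoc]
      homEquiv_naturality_right := fun {T X Y} f g => by
        obtain ⟨f, rfl⟩ := (indDesc_bijective T X).2 f
        have h₁ : (Equiv.ofBijective indDesc (indDesc_bijective T X)).symm (indDesc f) = f :=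
          Equiv.symm_apply_apply (Equiv.ofBijective indDesc (indDesc_bijective T X)) f
        refine Eq.trans ?_ (congrArg (· ≫ g.hom) h₁).symm
        refine (Equiv.symm_apply_eq (Equiv.ofBijective indDesc (indDesc_bijective T Y))).2 ?_
        refine hom_ext <| ind_hom_ext 𝒢 fun h => ?_
        change indι 𝒢 T h ≫ (indDesc f).hom ≫ g.hom = indι 𝒢 T h ≫ (indDesc (f ≫ g.hom)).hom
        rw [indι_indDesc, indι_indDesc_assoc, Functor.map_comp, Category.assoc, hom_comm] }

/-- The canonical morphism `X ⟶ Ind (ω X)`. -/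
def toIndForget [Fintype G] (X : EquivariantObject 𝒢) : X ⟶ (Ind 𝒢).obj X.obj :=
  mkHom (∑ h, (X.lam h).inv ≫ indι 𝒢 X.obj h) fun g => by
    rw [Functor.map_sum, Preadditive.sum_comp, Preadditive.comp_sum]
    refine Fintype.sum_equiv (Equiv.mulRight g) _ _ fun h => ?_
    have h₁ := X.comm g h
    rw [Functor.map_comp, Category.assoc, map_indι_lam,
      ← cancel_epi ((𝒢.F g).map (X.lam h).hom), ← Functor.map_comp_assoc, Iso.hom_inv_id,
      reassoc_of% h₁]
    simp

/-- If `|G|` is invertible, every equivariant object `X` is a retract of `Ind (ω X)`. -/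
lemma nonempty_retract_ind (hG : IsInvertibleIn (Nat.card G) A) (X : EquivariantObject 𝒢) :
    Nonempty (Retract X ((Ind 𝒢).obj X.obj)) := by
  have := Fintype.ofFinite G
  obtain ⟨e, he, -⟩ := hG (𝟙 X.obj)
  refine ⟨⟨toIndForget X, indDesc e, hom_ext ?_⟩⟩
  change (∑ h, (X.lam h).inv ≫ indι 𝒢 X.obj h) ≫ (indDesc e).hom = 𝟙 X.obj
  -- Here `e` is `|G|⁻¹` times the identity, and the composite is the sum of its `|G|` conjugates.
  have h₁ : ∀ g : G, conj (X := X) (Y := X) g e = e := fun g => by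
    refine (hG (𝟙 X.obj)).unique ?_ he
    rw [conj, ← Preadditive.comp_nsmul, ← Preadditive.nsmul_comp, ← Functor.map_nsmul, he]
    simp
  rw [Preadditive.sum_comp]
  simp only [Category.assoc, indι_indDesc]
  refine (Finset.sum_congr rfl fun g _ => h₁ g).trans ?_
  rw [Finset.sum_const, Finset.card_univ, ← Nat.card_eq_fintype_card, he]

end Additive

/-! ### Classical generation by the induced object. -/

section Triangulated

variable {G : Type w} [Group G] [Finite G]
    {D : Type u} [Category.{v} D] [Preadditive D] [HasZeroObject D] [HasShift D ℤ]
    [∀ n : ℤ, (shiftFunctor D n).Additive] [Pretriangulated D]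
    (𝒢 : GroupAction G D) [AdmissibleAction 𝒢]
    [Pretriangulated (EquivariantObject 𝒢)] [IsTriangulated (EquivariantObject 𝒢)]
    [(forget 𝒢).IsTriangulated]

/-- The preimage under the exact functor `Ind` of the thick closure of `Ind T` is thick and contains
`T`, so every `Ind (ω X)` lies in that closure, and with it its retract `X`. -/
lemma generates_ind (hG : IsInvertibleIn (Nat.card G) D) (T : D)
    (hT : (ObjectProperty.singleton T).IsClassicalTriangulatedGenerator) :
    (ObjectProperty.singleton ((Ind 𝒢).obj T)).IsClassicalTriangulatedGenerator := by
  let := (indAdjunction 𝒢).leftAdjointCommShift ℤ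
  have := (indAdjunction 𝒢).commShift_of_rightAdjoint ℤ
  have := (indAdjunction 𝒢).isTriangulated_leftAdjoint
  let P := (ObjectProperty.singleton ((Ind 𝒢).obj T)).triangEnvelope
  have : (P.inverseImage (Ind 𝒢)).IsStableUnderRetracts :=
    ⟨fun r hY => P.prop_of_retract (r.map (Ind 𝒢)) hY⟩
  have h : (ObjectProperty.singleton T).triangEnvelope ≤ P.inverseImage (Ind 𝒢) := by
    rw [ObjectProperty.triangEnvelope_le_iff, ObjectProperty.singleton_le_iff]
    exact ObjectProperty.le_triangEnvelope _ _ (by simp)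
  rw [ObjectProperty.isClassicalTriangulatedGenerator_iff] at hT ⊢
  rw [eq_top_iff]
  intro X _
  obtain ⟨r⟩ := nonempty_retract_ind hG X
  exact ObjectProperty.IsStableUnderRetracts.of_retract r (h X.obj (by rw [hT]; trivial))

end Triangulated

end Equivariantization

end

theorem mainTheorem9 {G : Type w} [Group G] [Finite G]
    {D : Type u} [Category.{v} D] [Preadditive D] [HasZeroObject D] [HasShift D ℤ]
    [∀ n : ℤ, (shiftFunctor D n).Additive] [Pretriangulated D] [IsTriangulated D]
    [IsIdempotentComplete D]
    (𝒢 : GroupAction G D) [AdmissibleAction 𝒢]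
    (hG : IsInvertibleIn (Nat.card G) D)
    [Pretriangulated (EquivariantObject 𝒢)] [IsTriangulated (EquivariantObject 𝒢)]
    [(forget 𝒢).IsTriangulated]
    (T : D) (hT : IsTilting T) (hinv : 𝒢.IsInvariant T) :
    IsTilting ((Ind 𝒢).obj T) ∧
      MoritaEquivalentRings (End ((Ind 𝒢).obj T)) (SkewGroupRing ((Ind 𝒢).obj T)) ∧
      rightGlobalDimension (End ((Ind 𝒢).obj T)) = rightGlobalDimension (End T) := by
  classical
  have := Fintype.ofFinite G
  have H := inducedRing_ind 𝒢 T
  let E := indCopyDecomposition fun g => (hinv g).some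
  refine ⟨⟨fun n hn f => hom_ext ?_, generates_ind 𝒢 hG T hT.generates⟩,
    moritaEquivalentRings_matrix H.skewEquivMatrix, ?_⟩
  · exact E.eq_zero (shiftFunctor D n) (hT.hom_eq_zero n hn) f.hom
  · let E' := E.reindex (Finite.equivFin G).symm
    have : Nonempty (Fin (Nat.card G)) := ⟨⟨0, Nat.card_pos⟩⟩
    rw [← rightGlobalDimension_matrix (End T) (Fin (Nat.card G)),
      ← rightGlobalDimension_congr E'.endEquivMatrix]
    obtain ⟨e, he, -⟩ := hG (𝟙 ((Ind 𝒢).obj T).obj)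
    exact le_antisymm (H.rightGlobalDimension_le e (by rw [← nsmul_eq_mul]; exact he))
      H.rightGlobalDimension_ge
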